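/- Let $n\ge 0$ be an integer; all graphs are finite and simple. An edge coloring (by arbitrarily many colors, not necessarily proper) of a graph on $n$ vertices is called $2$-mean if the average over all $n$ vertices of the number of colors appearing on edges incident with the vertex is at most $2$. Let $RT(n,K_3,2\text{-mean})$ be the maximum number of edges of a graph on $n$ vertices that has a $2$-mean edge coloring without a monochromatic triangle, and let $RT(n,K_3,2)$ be the maximum number of edges of a graph on $n$ vertices that has an edge coloring with two colors without a monochromatic triangle. Let $t(n,k)$ be the number of edges of the Turán graph $T(n,k)$, the complete $k$-partite graph on $n$ vertices with vertex classes as equal in size as possible, and let $R(K_3,2)$ be the least $N$ such that every $2$-coloring of the edges of $K_N$ contains a monochromatic triangle. Then $$RT(n,K_3,2\text{-mean})=RT(n,K_3,2)=t(n,R(K_3,2)-1)=t(n,5)=\lfloor 0.4\,n^2\rfloor .$$ In particular, for every graph on $n$ vertices with more than $t(n,5)$ edges, every $2$-mean edge coloring contains a monochromatic triangle. -/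

import Mathlib

open SimpleGraph

universe u v

namespace MeanRamseyTuran

/-- Under the edge coloring `C` of `G` there is a monochromatic copy of `H`: some color class
contains `H` as a (not necessarily induced) subgraph. -/
def HasMonoCopy {V W K : Type*} {G : SimpleGraph V} (C : G.EdgeLabeling K)
    (H : SimpleGraph W) : Prop :=
  ∃ k : K, H.IsContained (C.labelGraph k)

/-- The set of colors incident with the vertex `x`. -/
def colorsAt {V K : Type*} {G : SimpleGraph V} (C : G.EdgeLabeling K) (x : V) : Set K :=
  {k | ∃ y, ∃ h : G.Adj x y, C.get x y h = k}

/-- An edge coloring is `ρ`-mean if the average, over all vertices, of the number of colors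
incident with a vertex is at most `ρ`. (The inequality is multiplied by the number of vertices.) -/
def IsMeanColoring {V K : Type*} [Fintype V] {G : SimpleGraph V} (C : G.EdgeLabeling K)
    (ρ : ℝ) : Prop :=
  ∑ x : V, ((colorsAt C x).ncard : ℝ) ≤ ρ * (Fintype.card V : ℝ)

/-- The possible numbers of edges of a `k`-edge-colored graph with `n` vertices having no
monochromatic copy of `H`. -/
def edgeCounts {W : Type*} (n : ℕ) (H : SimpleGraph W) (k : ℕ) : Set ℕ :=
  {m | ∃ (G : SimpleGraph (Fin n)) (C : G.EdgeLabeling (Fin k)),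
    ¬ HasMonoCopy C H ∧ G.edgeSet.ncard = m}

/-- The possible numbers of edges of a `ρ`-mean colored graph with `n` vertices having no
monochromatic copy of `H`. The number of colors used is not restricted. -/
def meanEdgeCounts {W : Type*} (n : ℕ) (H : SimpleGraph W) (ρ : ℝ) : Set ℕ :=
  {m | ∃ (G : SimpleGraph (Fin n)) (C : G.EdgeLabeling ℕ),
    IsMeanColoring C ρ ∧ ¬ HasMonoCopy C H ∧ G.edgeSet.ncard = m}

/-- The Ramsey–Turán number `RT(n, H, k)`. -/
noncomputable def RT {W : Type*} (n : ℕ) (H : SimpleGraph W) (k : ℕ) : ℕ :=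
  sSup (edgeCounts n H k)

/-- The mean Ramsey–Turán number `RT(n, H, ρ-mean)`. -/
noncomputable def meanRT {W : Type*} (n : ℕ) (H : SimpleGraph W) (ρ : ℝ) : ℕ :=
  sSup (meanEdgeCounts n H ρ)

/-- The Ramsey number `R(H, k)`: the least `N` such that every `k`-coloring of the edges of `K_N`
has a monochromatic copy of `H`. -/
noncomputable def ramseyNumber {W : Type*} (H : SimpleGraph W) (k : ℕ) : ℕ :=
  sInf {N | ∀ C : TopEdgeLabeling (Fin N) (Fin k), HasMonoCopy C H}

/-- The Turán number `t(n, k)`: the number of edges of the Turán graph `T(n, k)`. -/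
def turanNumber (n k : ℕ) : ℕ :=
  (turanGraph n k).edgeFinset.card

/-! The suprema above are attained maxima as soon as `H` has an edge. -/

theorem ncard_edgeSet_le {n : ℕ} (G : SimpleGraph (Fin n)) :
    G.edgeSet.ncard ≤ Nat.card (Sym2 (Fin n)) :=
  (Set.ncard_le_ncard (Set.subset_univ _) Set.finite_univ).trans (Set.ncard_univ _).le

theorem not_hasMonoCopy_bot {V W K : Type*} {H : SimpleGraph W} (hH : H ≠ ⊥)
    (C : (⊥ : SimpleGraph V).EdgeLabeling K) : ¬ HasMonoCopy C H := by
  rintro ⟨k, ⟨f⟩⟩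
  apply hH
  ext a b
  simp only [bot_adj, iff_false]
  intro hab
  exact C.labelGraph_le (f.toHom.map_adj hab)

theorem isGreatest_RT {W : Type*} (n : ℕ) {H : SimpleGraph W} (hH : H ≠ ⊥) (k : ℕ) :
    IsGreatest (edgeCounts n H k) (RT n H k) := by
  have hb : BddAbove (edgeCounts n H k) := by
    refine ⟨Nat.card (Sym2 (Fin n)), ?_⟩
    rintro m ⟨G, C, -, rfl⟩
    exact ncard_edgeSet_le G
  refine ⟨Nat.sSup_mem ⟨0, ⊥, fun e => (by simpa using e.2 : False).elim, ?_, by simp⟩ hb,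
    fun m hm => le_csSup hb hm⟩
  exact not_hasMonoCopy_bot hH _

theorem isGreatest_meanRT {W : Type*} (n : ℕ) {H : SimpleGraph W} (hH : H ≠ ⊥) {ρ : ℝ}
    (hρ : 0 ≤ ρ) : IsGreatest (meanEdgeCounts n H ρ) (meanRT n H ρ) := by
  have hb : BddAbove (meanEdgeCounts n H ρ) := by
    refine ⟨Nat.card (Sym2 (Fin n)), ?_⟩
    rintro m ⟨G, C, -, -, rfl⟩
    exact ncard_edgeSet_le G
  refine ⟨Nat.sSup_mem ⟨0, ⊥, fun _ => 0, ?_, not_hasMonoCopy_bot hH _, by simp⟩ hb,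
    fun m hm => le_csSup hb hm⟩
  simp only [IsMeanColoring, colorsAt]
  simp
  positivity

end MeanRamseyTuran

namespace MeanRamseyTuran

open Finset

/-! For a triangle-free coloring, let `c x` be the number of colors at `x` minus 2. It suffices to
show `e ≤ 2/5 n² + 3/20 n ∑ c x`, since 2-mean means `∑ c x ≤ 0`. This is the value at the all-ones
vector of nonnegativity of the form with entries `[x, y nonadjacent] + 3/20 (c x + c y) - 1/5`. The
form is affine along the exchange of weight between nonadjacent vertices, so a Motzkin–Straus
argument (`quadratic_nonneg_of_clique`) reduces to weights supported on a clique.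

On a clique the claim is `quadratic_nonneg`: Cauchy–Schwarz suffices for at most five vertices with
two or more colors each, and any further vertices force large palettes. With all palettes of size at
least 2, six vertices allow only four of size 2 (`card_filter_le_four`). A palette of size 1 forces
its color on every other vertex without using it between them, so palettes grow as such vertices are
peeled off.

The lower bound colors the Turán graph by two pentagons. -/

theorem mul_sum_le_sum_mul {V : Type*} {T : Finset V} {w c : V → ℝ} {k : ℝ} (hw : ∀ x ∈ T, 0 ≤ w x)
    (hc : ∀ x ∈ T, k ≤ c x) : k * ∑ x ∈ T, w x ≤ ∑ x ∈ T, w x * c x := by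
  rw [mul_sum]
  refine sum_le_sum fun x hx => ?_
  rw [mul_comm]
  exact mul_le_mul_of_nonneg_left (hc x hx) (hw x hx)

theorem mul_sub_two_le {w : ℝ} {k c : ℕ} (hw : 0 ≤ w) (hc : k ≤ c) :
    ((k : ℝ) - 2) * w ≤ w * ((c : ℝ) - 2) := by
  have : (k : ℝ) ≤ c := by exact_mod_cast hc
  nlinarith

/-! ### Palettes in triangle-free colorings of a clique -/

/-- A symmetric function assigning colors to pairs of elements of `S`, without monochromatic
triangles inside `S`, such that the colors of the pairs containing `x` belong to `P x`. -/
structure IsTriangleFreeColoringOn {V K : Type*} (S : Finset V) (f : V → V → K)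
    (P : V → Finset K) : Prop where
  symm : ∀ x ∈ S, ∀ y ∈ S, f x y = f y x
  mem : ∀ x ∈ S, ∀ y ∈ S, x ≠ y → f x y ∈ P x
  noMono : ∀ x ∈ S, ∀ y ∈ S, ∀ z ∈ S, x ≠ y → x ≠ z → y ≠ z → f x y = f x z → f x y ≠ f y z

namespace IsTriangleFreeColoringOn

variable {V K : Type*} {S : Finset V} {f : V → V → K}
  {P : V → Finset K}

theorem mono {T : Finset V} (h : IsTriangleFreeColoringOn S f P) (hT : T ⊆ S) :
    IsTriangleFreeColoringOn T f P where
  symm x hx y hy := h.symm x (hT hx) y (hT hy)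
  mem x hx y hy := h.mem x (hT hx) y (hT hy)
  noMono x hx y hy z hz := h.noMono x (hT hx) y (hT hy) z (hT hz)

variable [DecidableEq V] [DecidableEq K]

theorem eq_of_card_le {A F : Finset K} (hF : F ⊆ A) (hA : #A ≤ #F + 1) {a b : K} (ha : a ∈ A)
    (hb : b ∈ A) (ha' : a ∉ F) (hb' : b ∉ F) : a = b := by
  have h : #(A \ F) ≤ 1 := by rw [card_sdiff_of_subset hF]; omega
  exact card_le_one.1 h a (by simp [*]) b (by simp [*])

/-- If the colors of `F` occur at all vertices of `S`, but not inside `S`, and `S` has at least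
three vertices, then at most one vertex has a palette of size at most `#F + 1`. -/
theorem lt_card_of_card_le (h : IsTriangleFreeColoringOn S f P) {F : Finset K}
    (hF : ∀ x ∈ S, F ⊆ P x) (hF' : ∀ x ∈ S, ∀ y ∈ S, x ≠ y → f x y ∉ F) (hS : 3 ≤ #S)
    {x y : V} (hx : x ∈ S) (hy : y ∈ S) (hxy : x ≠ y) (hPx : #(P x) ≤ #F + 1) :
    #F + 1 < #(P y) := by
  by_contra! hPy
  obtain ⟨z, hz⟩ : ((S.erase x).erase y).Nonempty := by
    rw [← card_pos, card_erase_of_mem (by simp [hy, hxy.symm]), card_erase_of_mem hx]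
    omega
  simp only [mem_erase] at hz
  obtain ⟨hzy, hzx, hz⟩ := hz
  -- Outside `F` each of `x`, `y` has only one color, so `xz` and `yz` both share the color of `xy`.
  have h1 := eq_of_card_le (hF x hx) hPx (h.mem x hx y hy hxy) (h.mem x hx z hz hzx.symm)
    (hF' x hx y hy hxy) (hF' x hx z hz hzx.symm)
  have h2 := eq_of_card_le (hF y hy) hPy (h.mem y hy x hx hxy.symm) (h.mem y hy z hz hzy.symm)
    (hF' y hy x hx hxy.symm) (hF' y hy z hz hzy.symm)
  exact h.noMono x hx y hy z hz hxy hzx.symm hzy.symm h1 (by rw [h.symm x hx y hy, h2])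

/-- Removing a vertex `x` whose palette exceeds `F` by at most one color yields a further color
occurring at all the remaining vertices but not between them. -/
theorem exists_color_of_card_le (h : IsTriangleFreeColoringOn S f P) {F : Finset K}
    (hF : ∀ x ∈ S, F ⊆ P x) (hF' : ∀ x ∈ S, ∀ y ∈ S, x ≠ y → f x y ∉ F) (hS : 2 ≤ #S)
    {x : V} (hx : x ∈ S) (hPx : #(P x) ≤ #F + 1) :
    ∃ r ∉ F, (∀ y ∈ S.erase x, insert r F ⊆ P y) ∧
      ∀ y ∈ S.erase x, ∀ z ∈ S.erase x, y ≠ z → f y z ∉ insert r F := by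
  obtain ⟨y, hy⟩ : (S.erase x).Nonempty := by
    rw [← card_pos, card_erase_of_mem hx]; omega
  rw [mem_erase] at hy
  -- All edges at `x` have one color; a second edge of that color between their ends would close a
  -- triangle.
  have key : ∀ z ∈ S.erase x, f x z = f x y := by
    intro z hz
    rw [mem_erase] at hz
    exact eq_of_card_le (hF x hx) hPx (h.mem x hx z hz.2 hz.1.symm) (h.mem x hx y hy.2 hy.1.symm)
      (hF' x hx z hz.2 hz.1.symm) (hF' x hx y hy.2 hy.1.symm)
  refine ⟨f x y, hF' x hx y hy.2 hy.1.symm, ?_, ?_⟩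
  · intro z hz
    have hz' := mem_erase.1 hz
    refine insert_subset ?_ (hF z hz'.2)
    rw [← key z hz, h.symm x hx z hz'.2]
    exact h.mem z hz'.2 x hx hz'.1
  · intro u hu v hv huv
    have hu' := mem_erase.1 hu
    have hv' := mem_erase.1 hv
    rw [mem_insert, not_or]
    refine ⟨fun he => ?_, hF' u hu'.2 v hv'.2 huv⟩
    exact h.noMono x hx u hu'.2 v hv'.2 hu'.1.symm hv'.1.symm huv (by rw [key u hu, key v hv])
      (by rw [key u hu, he])

/-- Any edge at `x` inside `S` adds a color to `F`. -/
theorem lt_card_of_two_le (h : IsTriangleFreeColoringOn S f P) {F : Finset K}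
    (hF : ∀ x ∈ S, F ⊆ P x) (hF' : ∀ x ∈ S, ∀ y ∈ S, x ≠ y → f x y ∉ F) (hS : 2 ≤ #S)
    {x : V} (hx : x ∈ S) : #F + 1 ≤ #(P x) := by
  obtain ⟨y, hy⟩ : (S.erase x).Nonempty := by
    rw [← card_pos, card_erase_of_mem hx]; omega
  rw [mem_erase] at hy
  rw [← card_insert_of_notMem (hF' x hx y hy.2 hy.1.symm)]
  exact card_le_card (insert_subset (h.mem x hx y hy.2 hy.1.symm) (hF x hx))

/-- A triangle-free coloring of a set with at least six elements cannot have five elements with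
palettes of size at most two. -/
theorem card_filter_le_four (h : IsTriangleFreeColoringOn S f P) (hS : 6 ≤ #S) :
    #{x ∈ S | #(P x) ≤ 2} ≤ 4 := by
  by_contra! hT
  obtain ⟨x, hx⟩ : ({x ∈ S | #(P x) ≤ 2} : Finset V).Nonempty := card_pos.1 (by omega)
  obtain ⟨A, hAT, hA⟩ := exists_subset_card_eq (s := ({x ∈ S | #(P x) ≤ 2} : Finset V).erase x)
    (n := 4) (by rw [card_erase_of_mem hx]; omega)
  have hxA : x ∉ A := fun hxA => by simpa using hAT hxA
  have hTS : ∀ y ∈ A, y ∈ S ∧ #(P y) ≤ 2 := fun y hy => by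
    simpa using (mem_erase.1 (hAT hy)).2
  -- The sixth vertex `z` may have any palette; it only gives `x` a fifth edge, so that one of its
  -- two colors is used three times.
  obtain ⟨z, hzS, hz⟩ : ∃ z ∈ S, z ∉ insert x A := by
    refine exists_mem_notMem_of_card_lt_card ?_
    rw [card_insert_of_notMem hxA]; omega
  rw [mem_insert, not_or] at hz
  obtain ⟨hxS, hPx⟩ : x ∈ S ∧ #(P x) ≤ 2 := by simpa using hx
  have hcard : #(insert z A) = 5 := by rw [card_insert_of_notMem hz.2, hA]
  have hB : ∀ y ∈ insert z A, y ∈ S ∧ x ≠ y := by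
    intro y hy
    rcases mem_insert.1 hy with rfl | hy
    · exact ⟨hzS, Ne.symm hz.1⟩
    · exact ⟨(hTS y hy).1, fun e => hxA (e ▸ hy)⟩
  obtain ⟨r, -, hr⟩ := exists_lt_card_fiber_of_mul_lt_card_of_maps_to (s := insert z A) (t := P x)
    (f := f x) (n := 2) (fun y hy => h.mem x hxS y (hB y hy).1 (hB y hy).2) (by omega)
  -- Of three ends of `r`-edges at least two, `p` and `q`, differ from `z` and so have small
  -- palettes; `s` may be `z`.
  have hr2 : 1 < #(({y ∈ insert z A | f x y = r} : Finset V).erase z) := by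
    have := pred_card_le_card_erase (s := {y ∈ insert z A | f x y = r}) (a := z)
    omega
  obtain ⟨p, hp, q, hq, hpq⟩ := one_lt_card.1 hr2
  obtain ⟨s, hs⟩ : ((({y ∈ insert z A | f x y = r} : Finset V).erase p).erase q).Nonempty := by
    rw [← card_pos]
    have := pred_card_le_card_erase (s := {y ∈ insert z A | f x y = r}) (a := p)
    have := pred_card_le_card_erase
      (s := ({y ∈ insert z A | f x y = r} : Finset V).erase p) (a := q)
    omega
  simp only [mem_erase, mem_filter, mem_insert] at hp hq hs
  have hpA : p ∈ A := hp.2.1.resolve_left hp.1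
  have hqA : q ∈ A := hq.2.1.resolve_left hq.1
  have hpS := hTS p hpA
  have hqS := hTS q hqA
  have hsS := hB s (mem_insert.2 hs.2.2.1)
  have hxp : x ≠ p := (hB p (mem_insert.2 hp.2.1)).2
  have hxq : x ≠ q := (hB q (mem_insert.2 hq.2.1)).2
  have hmono : ∀ u ∈ S, ∀ v ∈ S, x ≠ u → x ≠ v → u ≠ v → f x u = r →
      f x v = r → f u v ∉ ({r} : Finset K) := by
    intro u hu v hv hxu hxv huv h1 h2
    rw [mem_singleton]
    intro h3
    exact h.noMono x hxS u hu v hv hxu hxv huv (by rw [h1, h2]) (by rw [h1, h3])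
  have hT3 : IsTriangleFreeColoringOn {p, q, s} f P := h.mono (by
    intro y hy
    simp only [mem_insert, mem_singleton] at hy
    rcases hy with rfl | rfl | rfl
    exacts [hpS.1, hqS.1, hsS.1])
  have hrP : ∀ u ∈ S, x ≠ u → f x u = r → ({r} : Finset K) ⊆ P u := by
    intro u hu hxu h1
    rw [singleton_subset_iff, ← h1, h.symm x hxS u hu]
    exact h.mem u hu x hxS hxu.symm
  have hall : ∀ y ∈ ({p, q, s} : Finset V), y ∈ S ∧ x ≠ y ∧ f x y = r := by
    intro y hy
    simp only [mem_insert, mem_singleton] at hy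
    rcases hy with rfl | rfl | rfl
    exacts [⟨hpS.1, hxp, hp.2.2⟩, ⟨hqS.1, hxq, hq.2.2⟩, ⟨hsS.1, hsS.2, hs.2.2.2⟩]
  have := hT3.lt_card_of_card_le (F := {r})
    (fun u hu => hrP u (hall u hu).1 (hall u hu).2.1 (hall u hu).2.2)
    (fun u hu v hv huv => hmono u (hall u hu).1 v (hall v hv).1 (hall u hu).2.1 (hall v hv).2.1 huv
      (hall u hu).2.2 (hall v hv).2.2)
    (card_eq_three.2 ⟨p, q, s, hpq, Ne.symm hs.2.1, Ne.symm hs.1, rfl⟩).ge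
    (x := p) (y := q) (by simp) (by simp) hpq (by simpa using hpS.2)
  simp only [card_singleton] at this
  omega

/-! ### The quadratic inequality on a clique -/

theorem quadratic_nonneg_of_forall_two_le (h : IsTriangleFreeColoringOn S f P) {w : V → ℝ}
    (hw : ∀ x ∈ S, 0 ≤ w x) (hP : ∀ x ∈ S, 2 ≤ #(P x)) :
    0 ≤ ∑ x ∈ S, w x ^ 2 + 3 / 10 * (∑ x ∈ S, w x) * ∑ x ∈ S, w x * ((#(P x) : ℝ) - 2)
      - 1 / 5 * (∑ x ∈ S, w x) ^ 2 := by
  have hW : 0 ≤ ∑ x ∈ S, w x := sum_nonneg hw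
  rcases le_or_gt #S 5 with hS | hS
  · have h1 : (∑ x ∈ S, w x) ^ 2 ≤ #S * ∑ x ∈ S, w x ^ 2 := sq_sum_le_card_mul_sum_sq
    have h2 : 0 * ∑ x ∈ S, w x ≤ ∑ x ∈ S, w x * ((#(P x) : ℝ) - 2) :=
      mul_sum_le_sum_mul hw fun x hx => by
        have : (2 : ℝ) ≤ #(P x) := by exact_mod_cast hP x hx
        linarith
    have h3 : 0 ≤ ∑ x ∈ S, w x ^ 2 := sum_nonneg fun x _ => sq_nonneg _
    have h4 : (#S : ℝ) ≤ 5 := by exact_mod_cast hS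
    nlinarith [mul_le_mul_of_nonneg_right h4 h3, mul_nonneg hW (by linarith :
      0 ≤ ∑ x ∈ S, w x * ((#(P x) : ℝ) - 2))]
  · have hT := h.card_filter_le_four hS
    set A := ({x ∈ S | #(P x) ≤ 2} : Finset V)
    have hAS : A ⊆ S := filter_subset _ _
    rw [← sum_sdiff hAS, ← sum_sdiff hAS, ← sum_sdiff hAS]
    have h1 : (∑ x ∈ A, w x) ^ 2 ≤ #A * ∑ x ∈ A, w x ^ 2 := sq_sum_le_card_mul_sum_sq
    have hα : 0 ≤ ∑ x ∈ A, w x := sum_nonneg fun x hx => hw x (hAS hx)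
    have hβ : 0 ≤ ∑ x ∈ S \ A, w x := sum_nonneg fun x hx => hw x (sdiff_subset hx)
    have h2 : 0 * ∑ x ∈ A, w x ≤ ∑ x ∈ A, w x * ((#(P x) : ℝ) - 2) :=
      mul_sum_le_sum_mul (fun x hx => hw x (hAS hx)) fun x hx => by
        have : (2 : ℝ) ≤ #(P x) := by exact_mod_cast hP x (hAS hx)
        linarith
    have h2' : 1 * ∑ x ∈ S \ A, w x ≤ ∑ x ∈ S \ A, w x * ((#(P x) : ℝ) - 2) :=
      mul_sum_le_sum_mul (fun x hx => hw x (sdiff_subset hx)) fun x hx => by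
        have : 3 ≤ #(P x) := by
          by_contra! hlt
          exact (mem_sdiff.1 hx).2 (mem_filter.2 ⟨(mem_sdiff.1 hx).1, by omega⟩)
        have : (3 : ℝ) ≤ #(P x) := by exact_mod_cast this
        linarith
    have h3 : 0 ≤ ∑ x ∈ A, w x ^ 2 := sum_nonneg fun x _ => sq_nonneg _
    have h3' : 0 ≤ ∑ x ∈ S \ A, w x ^ 2 := sum_nonneg fun x _ => sq_nonneg _
    have h4 : (#A : ℝ) ≤ 4 := by exact_mod_cast hT
    have h5 := mul_le_mul_of_nonneg_right h4 h3
    generalize ∑ x ∈ A, w x = α at *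
    generalize ∑ x ∈ S \ A, w x = β at *
    have h6 := mul_le_mul_of_nonneg_left (add_le_add h2' h2) (add_nonneg hβ hα)
    -- The form is at least `α²/4 + 3/10 (α + β) β - (α + β)²/5 = ((α - β)² + β²)/20`.
    nlinarith [sq_nonneg (α - β), sq_nonneg β]

/-- The quadratic inequality for sets with at least three elements, one of which has a palette of
size one. -/
theorem quadratic_nonneg_of_card_le_one (h : IsTriangleFreeColoringOn S f P) {w : V → ℝ}
    (hw : ∀ x ∈ S, 0 ≤ w x) (hS : 3 ≤ #S) {x : V} (hx : x ∈ S) (hPx : #(P x) ≤ 1) :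
    0 ≤ ∑ x ∈ S, w x ^ 2 + 3 / 10 * (∑ x ∈ S, w x) * ∑ x ∈ S, w x * ((#(P x) : ℝ) - 2)
      - 1 / 5 * (∑ x ∈ S, w x) ^ 2 := by
  have hF0 : ∀ y ∈ S, ∅ ⊆ P y := fun _ _ => empty_subset _
  have hF0' : ∀ y ∈ S, ∀ z ∈ S, y ≠ z → f y z ∉ (∅ : Finset K) := fun _ _ _ _ _ => notMem_empty _
  obtain ⟨r, -, hr, hr'⟩ := h.exists_color_of_card_le hF0 hF0' (by omega) hx (by simpa using hPx)
  have hx1 : 1 ≤ #(P x) := by simpa using h.lt_card_of_two_le hF0 hF0' (by omega) hx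
  set T := S.erase x with hT
  have hTc : #T + 1 = #S := card_erase_add_one hx
  have hTS : T ⊆ S := erase_subset _ _
  have hT2 : ∀ y ∈ T, 2 ≤ #(P y) := fun y hy => by
    simpa using (h.mono hTS).lt_card_of_two_le hr hr' (by omega) hy
  have ea := mul_sub_two_le (hw x hx) hx1
  have ha := hw x hx
  rw [← add_sum_erase _ _ hx, ← add_sum_erase _ _ hx, ← add_sum_erase _ _ hx, ← hT]
  generalize w x = a at *
  generalize a * ((#(P x) : ℝ) - 2) = a' at *
  have hβ : 0 ≤ ∑ y ∈ T, w y := sum_nonneg fun y hy => hw y (hTS hy)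
  push_cast at ea
  by_cases hy : ∃ y ∈ T, #(P y) ≤ 2
  swap
  · push Not at hy
    have h2 : 1 * ∑ y ∈ T, w y ≤ ∑ y ∈ T, w y * ((#(P y) : ℝ) - 2) :=
      mul_sum_le_sum_mul (fun y hy => hw y (hTS hy)) fun y hy' => by
        have : (3 : ℝ) ≤ #(P y) := by exact_mod_cast hy y hy'
        linarith
    have h3 : 0 ≤ ∑ y ∈ T, w y ^ 2 := sum_nonneg fun x _ => sq_nonneg _
    generalize ∑ y ∈ T, w y = β at *
    have h6 := mul_le_mul_of_nonneg_left (add_le_add ea h2) (add_nonneg ha hβ)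
    -- Here and below `a²` has coefficient `1 - 3/10 - 1/5 = 1/2`, and the first square completes
    -- the square in `a`: weights with palette bound 2, 3, 4 enter it with factors 0.7, 0.4, 0.1.
    linarith [sq_nonneg (a - 0.4 * β), sq_nonneg β]
  obtain ⟨y, hy, hPy⟩ := hy
  -- Second peeling, with `F = {r}`: the vertices other than `x`, `y` carry both `r` and `b` but use
  -- neither among themselves.
  obtain ⟨b, hb, hb1, hb2⟩ := (h.mono hTS).exists_color_of_card_le hr hr' (by omega) hy
    (by simpa using hPy)
  rcases le_or_gt #T 2 with hT3 | hT3
  · have h1 : (∑ x ∈ T, w x) ^ 2 ≤ #T * ∑ x ∈ T, w x ^ 2 := sq_sum_le_card_mul_sum_sq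
    have h2 : 0 * ∑ y ∈ T, w y ≤ ∑ y ∈ T, w y * ((#(P y) : ℝ) - 2) :=
      mul_sum_le_sum_mul (fun y hy => hw y (hTS hy)) fun y hy' => by
        have : (2 : ℝ) ≤ #(P y) := by exact_mod_cast hT2 y hy'
        linarith
    have h3 : 0 ≤ ∑ y ∈ T, w y ^ 2 := sum_nonneg fun x _ => sq_nonneg _
    have h4 : (#T : ℝ) ≤ 2 := by exact_mod_cast hT3
    have h5 := mul_le_mul_of_nonneg_right h4 h3
    generalize ∑ y ∈ T, w y = β at *
    have h6 := mul_le_mul_of_nonneg_left (add_le_add ea h2) (add_nonneg ha hβ)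
    linarith [sq_nonneg (a - 0.7 * β), sq_nonneg β]
  set R := T.erase y with hR
  have hRT : R ⊆ T := erase_subset _ _
  have hRS : R ⊆ S := hRT.trans hTS
  have hcb : #(insert b (insert r (∅ : Finset K))) = 2 := by
    rw [card_insert_of_notMem hb, card_insert_of_notMem (notMem_empty r), card_empty]
  have hR3 : ∀ z ∈ R, 3 ≤ #(P z) := fun z hz => by
    have := (h.mono hTS).lt_card_of_card_le hr hr' hT3 hy (mem_of_mem_erase hz)
      (ne_of_mem_erase hz).symm (by simpa using hPy)
    rw [card_insert_of_notMem (notMem_empty r), card_empty] at this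
    omega
  have eb := mul_sub_two_le (hw y (hTS hy)) (hT2 y hy)
  have hb0 := hw y (hTS hy)
  rw [← add_sum_erase _ _ hy, ← hR] at hβ
  rw [← add_sum_erase _ _ hy, ← add_sum_erase _ _ hy, ← add_sum_erase _ _ hy, ← hR]
  generalize w y = b at *
  generalize b * ((#(P y) : ℝ) - 2) = b' at *
  push_cast at eb
  have hγ : 0 ≤ ∑ y ∈ R, w y := sum_nonneg fun y hy => hw y (hRS hy)
  rcases le_or_gt #R 2 with hR4 | hR4
  · have h1 : (∑ x ∈ R, w x) ^ 2 ≤ #R * ∑ x ∈ R, w x ^ 2 := sq_sum_le_card_mul_sum_sq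
    have h2 : 1 * ∑ y ∈ R, w y ≤ ∑ y ∈ R, w y * ((#(P y) : ℝ) - 2) :=
      mul_sum_le_sum_mul (fun y hy => hw y (hRS hy)) fun y hy' => by
        have : (3 : ℝ) ≤ #(P y) := by exact_mod_cast hR3 y hy'
        linarith
    have h3 : 0 ≤ ∑ y ∈ R, w y ^ 2 := sum_nonneg fun x _ => sq_nonneg _
    have h4 : (#R : ℝ) ≤ 2 := by exact_mod_cast hR4
    have h5 := mul_le_mul_of_nonneg_right h4 h3
    generalize ∑ y ∈ R, w y = γ at *
    have h6 := mul_le_mul_of_nonneg_left (add_le_add ea (add_le_add eb h2)) (add_nonneg ha hβ)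
    linarith [sq_nonneg (a - 0.7 * b - 0.4 * γ), sq_nonneg (b - γ), sq_nonneg γ, sq_nonneg b]
  by_cases hd : ∃ d ∈ R, #(P d) ≤ 3
  swap
  · push Not at hd
    have h2 : 2 * ∑ y ∈ R, w y ≤ ∑ y ∈ R, w y * ((#(P y) : ℝ) - 2) :=
      mul_sum_le_sum_mul (fun y hy => hw y (hRS hy)) fun y hy' => by
        have : (4 : ℝ) ≤ #(P y) := by exact_mod_cast hd y hy'
        linarith
    have h3 : 0 ≤ ∑ y ∈ R, w y ^ 2 := sum_nonneg fun x _ => sq_nonneg _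
    generalize ∑ y ∈ R, w y = γ at *
    have h6 := mul_le_mul_of_nonneg_left (add_le_add ea (add_le_add eb h2)) (add_nonneg ha hβ)
    linarith [sq_nonneg (a - 0.7 * b - 0.1 * γ), sq_nonneg γ, sq_nonneg b, mul_nonneg hb0 hγ]
  obtain ⟨d, hd, hPd⟩ := hd
  set Q := R.erase d with hQ
  have hQR : Q ⊆ R := erase_subset _ _
  have hQ4 : ∀ z ∈ Q, 4 ≤ #(P z) := fun z hz => by
    have := (h.mono hRS).lt_card_of_card_le hb1 hb2 hR4 hd (mem_of_mem_erase hz)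
      (ne_of_mem_erase hz).symm (by rw [hcb]; exact hPd)
    rw [hcb] at this
    omega
  have ed := mul_sub_two_le (hw d (hRS hd)) (hR3 d hd)
  have hd0 := hw d (hRS hd)
  rw [← add_sum_erase _ _ hd, ← hQ] at hβ
  rw [← add_sum_erase _ _ hd, ← add_sum_erase _ _ hd, ← add_sum_erase _ _ hd, ← hQ]
  generalize w d = d at *
  generalize d * ((#(P _) : ℝ) - 2) = d' at *
  push_cast at ed
  have h2 : 2 * ∑ y ∈ Q, w y ≤ ∑ y ∈ Q, w y * ((#(P y) : ℝ) - 2) :=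
    mul_sum_le_sum_mul (fun y hy => hw y (hRS (hQR hy))) fun y hy' => by
      have : (4 : ℝ) ≤ #(P y) := by exact_mod_cast hQ4 y hy'
      linarith
  -- Peeling stops here: palettes of size 4 compensate even when the squares on `Q` are discarded.
  have h3 : 0 ≤ ∑ y ∈ Q, w y ^ 2 := sum_nonneg fun x _ => sq_nonneg _
  have hδ : 0 ≤ ∑ y ∈ Q, w y := sum_nonneg fun y hy => hw y (hRS (hQR hy))
  generalize ∑ y ∈ Q, w y = δ at *
  have h6 := mul_le_mul_of_nonneg_left
    (add_le_add ea (add_le_add eb (add_le_add ed h2))) (add_nonneg ha hβ)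
  linarith [sq_nonneg (a - 0.7 * b - 0.4 * d - 0.1 * δ), sq_nonneg (b - d), sq_nonneg δ,
    sq_nonneg b, sq_nonneg d, mul_nonneg hb0 hδ, mul_nonneg hd0 hδ]

/-- The quadratic inequality underlying the bound on the number of edges. -/
theorem quadratic_nonneg (h : IsTriangleFreeColoringOn S f P) {w : V → ℝ}
    (hw : ∀ x ∈ S, 0 ≤ w x) :
    0 ≤ ∑ x ∈ S, w x ^ 2 + 3 / 10 * (∑ x ∈ S, w x) * ∑ x ∈ S, w x * ((#(P x) : ℝ) - 2)
      - 1 / 5 * (∑ x ∈ S, w x) ^ 2 := by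
  rcases le_or_gt #S 2 with hS | hS
  · have hW : 0 ≤ ∑ x ∈ S, w x := sum_nonneg hw
    have h1 : (∑ x ∈ S, w x) ^ 2 ≤ #S * ∑ x ∈ S, w x ^ 2 := sq_sum_le_card_mul_sum_sq
    have h3 : 0 ≤ ∑ x ∈ S, w x ^ 2 := sum_nonneg fun x _ => sq_nonneg _
    rcases Nat.lt_or_ge #S 2 with hS1 | hS2
    · have h2 : (-2) * ∑ y ∈ S, w y ≤ ∑ y ∈ S, w y * ((#(P y) : ℝ) - 2) :=
        mul_sum_le_sum_mul hw fun y hy' => by simp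
      have h4 : (#S : ℝ) ≤ 1 := by exact_mod_cast Nat.le_of_lt_succ hS1
      have h5 := mul_le_mul_of_nonneg_right h4 h3
      have h6 := mul_le_mul_of_nonneg_left h2 hW
      nlinarith
    -- This case bounds the constant 3/10 from above: equal weights and palettes of size 1 give `1/2
    -- - 3/10 - 1/5 = 0`.
    · have h2 : (-1) * ∑ y ∈ S, w y ≤ ∑ y ∈ S, w y * ((#(P y) : ℝ) - 2) :=
        mul_sum_le_sum_mul hw fun y hy => by
          have : 1 ≤ #(P y) := by
            simpa using h.lt_card_of_two_le (F := ∅) (by simp) (by simp) hS2 hy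
          have : (1 : ℝ) ≤ #(P y) := by exact_mod_cast this
          linarith
      have h4 : (#S : ℝ) ≤ 2 := by exact_mod_cast hS
      have h5 := mul_le_mul_of_nonneg_right h4 h3
      have h6 := mul_le_mul_of_nonneg_left h2 hW
      nlinarith
  · by_cases hx : ∃ x ∈ S, #(P x) ≤ 1
    · obtain ⟨x, hx, hPx⟩ := hx
      exact h.quadratic_nonneg_of_card_le_one hw hS hx hPx
    · push Not at hx
      exact h.quadratic_nonneg_of_forall_two_le hw hx

end IsTriangleFreeColoringOn

/-! ### Reduction to cliques -/

/-- Motzkin–Straus reduction: a symmetric quadratic form which is concave in every direction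
`Pi.single x 1 - Pi.single y 1` with `x`, `y` nonadjacent is nonnegative on nonnegative vectors if
it is so on those whose support is a clique. -/
theorem quadratic_nonneg_of_clique {V : Type*} [Fintype V] [DecidableEq V] (G : SimpleGraph V)
    (M : V → V → ℝ) (hsymm : ∀ x y, M x y = M y x)
    (hM : ∀ x y, x ≠ y → ¬ G.Adj x y → M x x + M y y ≤ 2 * M x y)
    (hclique : ∀ (S : Finset V) (w : V → ℝ), G.IsClique (S : Set V) → (∀ x, 0 ≤ w x) →
      (∀ x ∉ S, w x = 0) → 0 ≤ ∑ x, ∑ y, M x y * (w x * w y))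
    (w : V → ℝ) (hw : ∀ x, 0 ≤ w x) : 0 ≤ ∑ x, ∑ y, M x y * (w x * w y) := by
  induction hk : #{x | w x ≠ 0} using Nat.strong_induction_on generalizing w with
  | _ k ih =>
  by_cases hc : G.IsClique (({x | w x ≠ 0} : Finset V) : Set V)
  · exact hclique _ w hc hw (by simp)
  obtain ⟨x, hx, y, hy, hxy, hadj⟩ : ∃ x, w x ≠ 0 ∧ ∃ y, w y ≠ 0 ∧ x ≠ y ∧ ¬ G.Adj x y := by
    simpa [isClique_iff, Set.Pairwise] using hc
  have hx0 := lt_of_le_of_ne (hw x) hx.symm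
  have hy0 := lt_of_le_of_ne (hw y) hy.symm
  set d : V → ℝ := Pi.single x 1 - Pi.single y 1 with hd
  have hdsum : ∀ g : V → ℝ, ∑ a, d a * g a = g x - g y := fun g => by
    simp [hd, sub_mul, sum_sub_distrib, Pi.single_apply]
  have expand : ∀ t : ℝ, ∑ a, ∑ b, M a b * ((w + t • d) a * (w + t • d) b) =
      (∑ a, ∑ b, M a b * (w a * w b)) + t * (2 * ∑ b, (M x b - M y b) * w b) +
        t ^ 2 * (M x x + M y y - 2 * M x y) := by
    intro t
    have h1 : ∑ a, d a * ∑ b, M a b * w b = ∑ b, (M x b - M y b) * w b := by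
      rw [hdsum, ← sum_sub_distrib]
      simp_rw [sub_mul]
    have h2 : ∑ a, ∑ b, M a b * w a * d b = ∑ b, (M x b - M y b) * w b := by
      rw [← h1, sum_comm]
      refine sum_congr rfl fun a _ => ?_
      rw [mul_sum]
      refine sum_congr rfl fun b _ => ?_
      rw [hsymm b a]; ring
    have h3 : ∑ a, d a * ∑ b, d b * M a b = M x x + M y y - 2 * M x y := by
      simp_rw [hdsum]
      rw [hsymm y x]; ring
    rw [← h3, two_mul, mul_add]
    nth_rewrite 1 [← h1]
    rw [← h2]
    simp_rw [mul_sum, ← sum_add_distrib]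
    refine sum_congr rfl fun a _ => sum_congr rfl fun b _ => ?_
    simp only [Pi.add_apply, Pi.smul_apply, smul_eq_mul]
    ring
  have step : ∀ t : ℝ, (∀ z, 0 ≤ (w + t • d) z) →
      (∃ z, w z ≠ 0 ∧ (w + t • d) z = 0) →
      0 ≤ (∑ a, ∑ b, M a b * (w a * w b)) +
      t * (2 * ∑ b, (M x b - M y b) * w b) + t ^ 2 * (M x x + M y y - 2 * M x y) := by
    intro t ht ⟨z, hz, hz'⟩
    rw [← expand]
    refine ih _ ?_ _ ht rfl
    rw [← hk]
    refine card_lt_card ⟨?_, fun hsub => ?_⟩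
    · intro a
      simp only [mem_filter, mem_univ, true_and]
      intro ha h0
      rcases eq_or_ne a x with rfl | hax
      · exact hx h0
      rcases eq_or_ne a y with rfl | hay
      · exact hy h0
      simp [hd, hax, hay, h0] at ha
    · have := hsub (by simpa using hz : z ∈ ({x | w x ≠ 0} : Finset V))
      simp only [mem_filter, mem_univ, true_and] at this
      exact this hz'
  have hnn : ∀ t : ℝ, -w x ≤ t → t ≤ w y →
      ∀ z, 0 ≤ (w + t • d) z := by
    intro t h1 h2 z
    have := hw z
    simp only [Pi.add_apply, Pi.smul_apply, Pi.sub_apply, Pi.single_apply, hd, smul_eq_mul]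
    split_ifs with h3 h4 h4
    · exact absurd (h3.symm.trans h4) hxy
    · subst h3; linarith
    · subst h4; linarith
    · linarith
  -- At the two ends of the admissible interval for `t` one coordinate vanishes, so the support
  -- shrinks.
  have s1 := step (w y) (hnn _ (by linarith) le_rfl) ⟨y, hy, by simp [hd, hxy.symm]⟩
  have s2 := step (-w x) (hnn _ le_rfl (by linarith)) ⟨x, hx, by simp [hd, hxy]⟩
  have h2 := hM x y hxy hadj
  generalize ∑ b, (M x b - M y b) * w b = L at *
  generalize ∑ a, ∑ b, M a b * (w a * w b) = Q at *
  -- Concavity in `t`: weighting the end values by `w x` and `w y` cancels the linear term.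
  have h4 : 0 ≤ (w x + w y) * Q := by
    have := mul_nonneg hx0.le s1
    have := mul_nonneg hy0.le s2
    have := mul_nonneg (mul_nonneg (mul_nonneg hx0.le hy0.le) (add_nonneg hx0.le hy0.le))
      (sub_nonneg.2 h2)
    nlinarith
  exact nonneg_of_mul_nonneg_right h4 (by linarith)

/-! ### The edge bound for colored graphs -/

theorem hasMonoCopy_of_adj {V K : Type*} {G : SimpleGraph V} {C : G.EdgeLabeling K} {k : K}
    {x y z : V} (hxy : (C.labelGraph k).Adj x y) (hxz : (C.labelGraph k).Adj x z)
    (hyz : (C.labelGraph k).Adj y z) : HasMonoCopy C (completeGraph (Fin 3)) := by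
  classical
  exact ⟨k, (not_cliqueFree_iff_top_isContained 3).1 fun h =>
    h {x, y, z} (is3Clique_triple_iff.2 ⟨hxy, hxz, hyz⟩)⟩

theorem exists_adj_of_hasMonoCopy {V K : Type*} {G : SimpleGraph V} {C : G.EdgeLabeling K}
    (h : HasMonoCopy C (completeGraph (Fin 3))) : ∃ k x y z,
      (C.labelGraph k).Adj x y ∧ (C.labelGraph k).Adj x z ∧ (C.labelGraph k).Adj y z := by
  obtain ⟨k, ⟨f⟩⟩ := h
  exact ⟨k, f 0, f 1, f 2, f.toHom.map_adj (by simp), f.toHom.map_adj (by simp),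
    f.toHom.map_adj (by simp)⟩

theorem finite_colorsAt {V K : Type*} [Finite V] {G : SimpleGraph V} (C : G.EdgeLabeling K)
    (x : V) : (colorsAt C x).Finite := by
  refine (Set.finite_range fun y : {y // G.Adj x y} => C.get x y y.2).subset ?_
  rintro k ⟨y, hy, rfl⟩
  exact ⟨⟨y, hy⟩, rfl⟩

/-- Palettes record the colors at `x` in all of `G`, so they do not depend on the clique; `none` is
a dummy color for nonadjacent pairs. -/
theorem isTriangleFreeColoringOn_of_isClique {V K : Type*} [Finite V] {G : SimpleGraph V}
    (C : G.EdgeLabeling K) (hC : ¬ HasMonoCopy C (completeGraph (Fin 3))) {S : Finset V}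
    (hS : G.IsClique (S : Set V)) : ∃ (f : V → V → Option K) (P : V → Finset (Option K)),
      IsTriangleFreeColoringOn S f P ∧ ∀ x, #(P x) = (colorsAt C x).ncard := by
  classical
  refine ⟨fun x y => if h : G.Adj x y then some (C.get x y h) else none,
    fun x => (finite_colorsAt C x).toFinset.map Function.Embedding.some, ⟨?_, ?_, ?_⟩, fun x => ?_⟩
  · intro x _ y _
    by_cases h : G.Adj x y
    · simp [h, h.symm, EdgeLabeling.get_comm x y]
    · simp [h, mt (fun h' : G.Adj y x => h'.symm) h]
  · intro x hx y hy hxy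
    have h := hS hx hy hxy
    simp only [h, dite_true, mem_map, Set.Finite.mem_toFinset, Function.Embedding.some_apply]
    exact ⟨_, ⟨y, h, rfl⟩, rfl⟩
  · intro x hx y hy z hz hxy hxz hyz h1 h2
    simp only [hS hx hy hxy, hS hx hz hxz, hS hy hz hyz, dite_true, Option.some.injEq] at h1 h2
    refine hC (hasMonoCopy_of_adj (k := C.get x y (hS hx hy hxy)) (x := x) (y := y) (z := z)
      ?_ ?_ ?_) <;> rw [EdgeLabeling.labelGraph_adj]
    exacts [⟨_, rfl⟩, ⟨_, h1.symm⟩, ⟨_, h2.symm⟩]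
  · rw [card_map, Set.ncard_eq_toFinset_card _ (finite_colorsAt C x)]

theorem sum_sum_ite_adj_zero_one {V : Type*} [Fintype V] (G : SimpleGraph V) [DecidableRel G.Adj] :
    ∑ x, ∑ y, (if G.Adj x y then (0 : ℝ) else 1) =
      (Fintype.card V : ℝ) ^ 2 - 2 * G.edgeSet.ncard := by
  classical
  have h1 : (∑ x, ∑ y, if G.Adj x y then (1 : ℝ) else 0) = 2 * G.edgeSet.ncard := by
    have h := G.sum_degrees_eq_twice_card_edges
    rw [← coe_edgeFinset G, Set.ncard_coe_finset]
    rw [← Nat.cast_ofNat, ← Nat.cast_mul, ← h, Nat.cast_sum]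
    refine sum_congr rfl fun x _ => ?_
    rw [← card_neighborFinset_eq_degree, neighborFinset_eq_filter, sum_boole]
  rw [← h1, eq_sub_iff_add_eq, ← sum_add_distrib]
  simp_rw [← sum_add_distrib]
  have : ∀ x y, ((if G.Adj x y then (0 : ℝ) else 1) + if G.Adj x y then 1 else 0) = 1 := by
    intro x y; split_ifs <;> norm_num
  simp [this, sq]

/-- Every edge coloring without monochromatic triangles satisfies a bound on the number of edges
in terms of the number of colors at the vertices. -/
theorem ncard_edgeSet_le_of_not_hasMonoCopy {V K : Type*} [Fintype V] {G : SimpleGraph V}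
    (C : G.EdgeLabeling K) (hC : ¬ HasMonoCopy C (completeGraph (Fin 3))) :
    (G.edgeSet.ncard : ℝ) ≤ 2 / 5 * (Fintype.card V : ℝ) ^ 2 + 3 / 20 * Fintype.card V *
      (∑ x, ((colorsAt C x).ncard : ℝ) - 2 * Fintype.card V) := by
  classical
  set c : V → ℝ := fun x => ((colorsAt C x).ncard : ℝ) - 2 with hc
  have expand : ∀ w : V → ℝ, ∑ x, ∑ y,
      ((if G.Adj x y then 0 else 1) + 3 / 20 * (c x + c y) - 1 / 5) * (w x * w y) =
        ∑ x, ∑ y, (if G.Adj x y then 0 else 1) * (w x * w y) +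
        3 / 10 * (∑ x, w x) * (∑ x, w x * c x) - 1 / 5 * (∑ x, w x) ^ 2 := by
    intro w
    have h1 : (∑ x, w x) * (∑ x, w x * c x) = ∑ x, ∑ y, w x * w y * c y := by
      rw [sum_mul_sum]; simp_rw [mul_assoc]
    have h2 : (∑ x, w x) * (∑ x, w x * c x) = ∑ x, ∑ y, w x * w y * c x := by
      rw [mul_comm, sum_mul_sum]
      exact sum_congr rfl fun x _ => sum_congr rfl fun y _ => by ring
    have h3 : 3 / 10 * (∑ x, w x) * (∑ x, w x * c x) =
        3 / 20 * (∑ x, ∑ y, w x * w y * c y) + 3 / 20 * (∑ x, ∑ y, w x * w y * c x) := by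
      rw [← h1, ← h2]; ring
    rw [h3, sq, sum_mul_sum]
    simp_rw [mul_sum, ← sum_add_distrib, ← sum_sub_distrib]
    exact sum_congr rfl fun x _ => sum_congr rfl fun y _ => by ring
  -- For nonadjacent `x`, `y` all three indicators are 1, and the concavity condition holds with
  -- equality.
  have key := quadratic_nonneg_of_clique G
    (fun x y => (if G.Adj x y then 0 else 1) + 3 / 20 * (c x + c y) - 1 / 5)
    (fun x y => by simp only [G.adj_comm x y, add_comm (c x)])
    (fun x y _ h => by simp only [h, if_false, SimpleGraph.irrefl]; linarith)
    (fun S w hS hw hw0 => by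
      obtain ⟨f, P, h, hP⟩ := isTriangleFreeColoringOn_of_isClique C hC hS
      have hq := h.quadratic_nonneg (w := w) fun x _ => hw x
      have hsub : ∀ g : V → ℝ, (∀ x ∉ S, g x = 0) → ∑ x ∈ S, g x = ∑ x, g x := fun g hg =>
        sum_subset (subset_univ S) fun x _ hx => hg x hx
      simp_rw [hP] at hq
      rw [hsub w hw0, hsub (fun x => w x * _) fun x hx => by simp [hw0 x hx],
        hsub (fun x => w x ^ 2) fun x hx => by simp [hw0 x hx]] at hq
      rw [expand w]
      have hd : ∑ x, ∑ y, (if G.Adj x y then 0 else 1) * (w x * w y) = ∑ x, w x ^ 2 := by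
        refine sum_congr rfl fun x _ => ?_
        rw [sum_eq_single x]
        · simp [sq]
        · intro y _ hyx
          by_cases hx : x ∈ S
          · by_cases hy : y ∈ S
            · simp [hS hx hy hyx.symm]
            · simp [hw0 y hy]
          · simp [hw0 x hx]
        · simp
      rw [hd]
      exact hq)
    (fun _ => 1) (fun _ => zero_le_one)
  rw [expand] at key
  simp only [mul_one, one_mul, sum_sum_ite_adj_zero_one] at key
  simp only [hc, sum_sub_distrib, sum_const, card_univ, nsmul_eq_mul, mul_one] at key
  linarith

/-! ### Turán numbers, extremal colorings and the Ramsey number -/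

theorem turanNumber_five (n : ℕ) : turanNumber n 5 = ⌊(0.4 : ℝ) * (n : ℝ) ^ 2⌋₊ := by
  have h : turanNumber n 5 = 2 * n ^ 2 / 5 := by
    rw [turanNumber, card_edgeFinset_turanGraph]
    obtain ⟨q, r, hr, rfl⟩ : ∃ q r, r < 5 ∧ n = 5 * q + r :=
      ⟨n / 5, n % 5, Nat.mod_lt _ (by norm_num), (Nat.div_add_mod n 5).symm⟩
    have hm : (5 * q + r) % 5 = r := by omega
    rw [hm]
    have h1 : (5 * q + r) ^ 2 - r ^ 2 = 5 * (5 * q ^ 2 + 2 * q * r) := by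
      rw [Nat.sub_eq_iff_eq_add (Nat.pow_le_pow_left (by omega) 2)]; ring
    have h2 : 5 * (5 * q ^ 2 + 2 * q * r) * (5 - 1) / (2 * 5) = 2 * (5 * q ^ 2 + 2 * q * r) := by
      rw [show 5 * (5 * q ^ 2 + 2 * q * r) * (5 - 1) =
        2 * (5 * q ^ 2 + 2 * q * r) * (2 * 5) by ring]
      exact Nat.mul_div_cancel _ (by norm_num)
    have h3 : 2 * (5 * q + r) ^ 2 = 2 * r ^ 2 + 2 * (5 * q ^ 2 + 2 * q * r) * 5 := by ring
    rw [h1, h2, h3, Nat.add_mul_div_right _ _ (by norm_num), add_comm]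
    congr 1
    -- For `r < 5`, both `r.choose 2` and `2 * r ^ 2 / 5` run through 0, 0, 1, 3, 6.
    interval_cases r <;> rfl
  rw [h, show (0.4 : ℝ) * (n : ℝ) ^ 2 = ((2 * n ^ 2 : ℕ) : ℝ) / (5 : ℕ) by push_cast; ring,
    Nat.floor_div_eq_div]

/-- A graph with a `2`-mean edge coloring without monochromatic triangles has at most as many
edges as the Turán graph with five classes. -/
theorem ncard_edgeSet_le_turanNumber {V K : Type*} [Fintype V] {G : SimpleGraph V}
    (C : G.EdgeLabeling K) (hm : IsMeanColoring C 2)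
    (hC : ¬ HasMonoCopy C (completeGraph (Fin 3))) :
    G.edgeSet.ncard ≤ turanNumber (Fintype.card V) 5 := by
  rw [turanNumber_five]
  refine Nat.le_floor ?_
  have h := ncard_edgeSet_le_of_not_hasMonoCopy C hC
  rw [IsMeanColoring] at hm
  have := mul_nonneg (Nat.cast_nonneg (α := ℝ) (Fintype.card V)) (sub_nonneg.2 hm)
  linarith

theorem isMeanColoring_of_fin {V : Type*} [Fintype V] {G : SimpleGraph V} {k : ℕ}
    (C : G.EdgeLabeling (Fin k)) : IsMeanColoring C k := by
  rw [IsMeanColoring]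
  calc ∑ x, ((colorsAt C x).ncard : ℝ) ≤ ∑ _x : V, (k : ℝ) := by
        refine sum_le_sum fun x _ => ?_
        have := Set.ncard_le_ncard (Set.subset_univ (colorsAt C x)) Set.finite_univ
        rw [Set.ncard_univ, Nat.card_fin] at this
        exact_mod_cast this
    _ = k * Fintype.card V := by simp [mul_comm]

theorem isMeanColoring_compRight {V K K' : Type*} [Fintype V] {G : SimpleGraph V}
    {C : G.EdgeLabeling K} {ρ : ℝ} (h : IsMeanColoring C ρ) (g : K → K') :
    IsMeanColoring (C.compRight g) ρ := by
  refine le_trans (sum_le_sum fun x _ => ?_) h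
  have : colorsAt (C.compRight g) x = g '' colorsAt C x := by
    ext k
    simp only [colorsAt, Set.mem_image, Set.mem_ofPred_eq, EdgeLabeling.compRight_get]
    grind
  rw [this]
  exact_mod_cast Set.ncard_image_le (finite_colorsAt C x)

theorem not_hasMonoCopy_compRight {V K K' : Type*} {G : SimpleGraph V}
    {C : G.EdgeLabeling K} (h : ¬ HasMonoCopy C (completeGraph (Fin 3))) {g : K → K'}
    (hg : g.Injective) : ¬ HasMonoCopy (C.compRight g) (completeGraph (Fin 3)) := by
  intro h'
  obtain ⟨k, x, y, z, h1, h2, h3⟩ := exists_adj_of_hasMonoCopy h'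
  simp only [EdgeLabeling.labelGraph_adj, EdgeLabeling.compRight_apply] at h1 h2 h3
  obtain ⟨a1, rfl⟩ := h1
  obtain ⟨a2, e2⟩ := h2
  obtain ⟨a3, e3⟩ := h3
  refine h (hasMonoCopy_of_adj (k := C ⟨s(x, y), a1⟩) (x := x) (y := y) (z := z) ?_ ?_ ?_) <;>
    rw [EdgeLabeling.labelGraph_adj]
  exacts [⟨_, rfl⟩, ⟨_, hg e2⟩, ⟨_, hg e3⟩]

/-- The coloring induced by the decomposition of `K₅` into two pentagons. -/
theorem exists_coloring_of_le_turanGraph {n : ℕ} {G : SimpleGraph (Fin n)}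
    (hG : G ≤ turanGraph n 5) :
    ∃ C : G.EdgeLabeling (Fin 2), ¬ HasMonoCopy C (completeGraph (Fin 3)) := by
  let p : Fin 5 → Fin 5 → Fin 2 := fun a b => if a = b + 1 ∨ b = a + 1 then 0 else 1
  have hp : ∀ a b, p b a = p a b := by decide
  have hp' : ∀ a b c, a ≠ b → a ≠ c → b ≠ c → ¬ (p a b = p a c ∧ p a b = p b c) := by decide
  let m : Fin n → Fin 5 := fun x => Fin.ofNat 5 x
  refine ⟨EdgeLabeling.mk (fun x y _ => p (m x) (m y)) fun x y _ => hp _ _, fun h => ?_⟩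
  obtain ⟨k, x, y, z, h1, h2, h3⟩ := exists_adj_of_hasMonoCopy h
  simp only [EdgeLabeling.labelGraph_adj] at h1 h2 h3
  obtain ⟨a1, e1⟩ := h1
  obtain ⟨a2, e2⟩ := h2
  obtain ⟨a3, e3⟩ := h3
  have hm : ∀ {x y}, G.Adj x y → m x ≠ m y := fun h e => hG h (congrArg Fin.val e)
  exact hp' (m x) (m y) (m z) (hm a1) (hm a2) (hm a3) ⟨e1.trans e2.symm, e1.trans e3.symm⟩

theorem completeGraph_three_ne_bot : completeGraph (Fin 3) ≠ ⊥ := top_ne_bot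

theorem turanNumber_mem_edgeCounts (n : ℕ) :
    turanNumber n 5 ∈ edgeCounts n (completeGraph (Fin 3)) 2 := by
  obtain ⟨C, hC⟩ := exists_coloring_of_le_turanGraph (le_refl (turanGraph n 5))
  refine ⟨turanGraph n 5, C, hC, ?_⟩
  rw [← coe_edgeFinset, Set.ncard_coe_finset, turanNumber]

theorem edgeCounts_subset_meanEdgeCounts (n k : ℕ) :
    edgeCounts n (completeGraph (Fin 3)) k ⊆ meanEdgeCounts n (completeGraph (Fin 3)) k := by
  rintro m ⟨G, C, hC, rfl⟩
  exact ⟨G, C.compRight Fin.val, isMeanColoring_compRight (isMeanColoring_of_fin C) _,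
    not_hasMonoCopy_compRight hC Fin.val_injective, rfl⟩

theorem meanRT_le_turanNumber (n : ℕ) :
    meanRT n (completeGraph (Fin 3)) 2 ≤ turanNumber n 5 := by
  obtain ⟨G, C, hm, hC, h⟩ := (isGreatest_meanRT n completeGraph_three_ne_bot zero_le_two).1
  rw [← h]
  simpa using ncard_edgeSet_le_turanNumber C hm hC

theorem RT_le_meanRT (n : ℕ) :
    RT n (completeGraph (Fin 3)) 2 ≤ meanRT n (completeGraph (Fin 3)) 2 :=
  (isGreatest_meanRT n completeGraph_three_ne_bot zero_le_two).2 <| by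
    simpa using edgeCounts_subset_meanEdgeCounts n 2
      (isGreatest_RT n completeGraph_three_ne_bot 2).1

theorem turanNumber_le_RT (n : ℕ) :
    turanNumber n 5 ≤ RT n (completeGraph (Fin 3)) 2 :=
  (isGreatest_RT n completeGraph_three_ne_bot 2).2 (turanNumber_mem_edgeCounts n)

/-- `K₆` has 15 edges, one more than `t(6, 5)`, and 2-colorings are 2-mean; for `N ≤ 5` the graph
`K_N` is its own Turán graph and has the pentagon coloring. -/
theorem ramseyNumber_three_two : ramseyNumber (completeGraph (Fin 3)) 2 = 6 := by
  have h6 : ∀ C : TopEdgeLabeling (Fin 6) (Fin 2), HasMonoCopy C (completeGraph (Fin 3)) := by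
    intro C
    by_contra hC
    have h := ncard_edgeSet_le_turanNumber C (by simpa using isMeanColoring_of_fin C) hC
    rw [← coe_edgeFinset, Set.ncard_coe_finset, card_edgeFinset_top_eq_card_choose_two,
      turanNumber, card_edgeFinset_turanGraph, Fintype.card_fin] at h
    exact absurd h (by decide)
  refine le_antisymm (Nat.sInf_le h6) (le_csInf ⟨6, h6⟩ fun N hN => ?_)
  by_contra! hlt
  obtain ⟨C, hC⟩ := exists_coloring_of_le_turanGraph
    (turanGraph_eq_top.2 (Or.inr (Nat.le_of_lt_succ hlt)) : turanGraph N 5 = ⊤).ge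
  exact hC (hN C)

end MeanRamseyTuran

theorem theorem1 (n : ℕ) :
    MeanRamseyTuran.meanRT n (completeGraph (Fin 3)) 2
        = MeanRamseyTuran.RT n (completeGraph (Fin 3)) 2 ∧
    MeanRamseyTuran.RT n (completeGraph (Fin 3)) 2
        = MeanRamseyTuran.turanNumber n
            (MeanRamseyTuran.ramseyNumber (completeGraph (Fin 3)) 2 - 1) ∧
    MeanRamseyTuran.turanNumber n
            (MeanRamseyTuran.ramseyNumber (completeGraph (Fin 3)) 2 - 1)
        = MeanRamseyTuran.turanNumber n 5 ∧
    MeanRamseyTuran.turanNumber n 5 = ⌊(0.4 : ℝ) * (n : ℝ) ^ 2⌋₊ ∧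
    (∀ (V : Type u) (K : Type v) [Fintype V] (G : SimpleGraph V) (C : G.EdgeLabeling K),
      Fintype.card V = n →
      MeanRamseyTuran.turanNumber n 5 < G.edgeSet.ncard →
      MeanRamseyTuran.IsMeanColoring C 2 →
      MeanRamseyTuran.HasMonoCopy C (completeGraph (Fin 3))) := by
  rw [MeanRamseyTuran.ramseyNumber_three_two]
  have h1 := MeanRamseyTuran.meanRT_le_turanNumber n
  have h2 := MeanRamseyTuran.RT_le_meanRT n
  have h3 := MeanRamseyTuran.turanNumber_le_RT n
  refine ⟨by omega, le_antisymm (h2.trans h1) h3, rfl, MeanRamseyTuran.turanNumber_five n, ?_⟩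
  rintro V K _ G C rfl hlt hm
  by_contra hC
  exact hlt.not_ge (MeanRamseyTuran.ncard_edgeSet_le_turanNumber C hm hC)
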